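/- Model. Stations have distinct identifiers in $[N]$ and pairwise distinct positions in the Euclidean plane; all transmission powers, the threshold and the ambient noise equal $1$; the path loss $\alpha\ge 2$ and the sensitivity $\varepsilon>0$ are fixed. In a round in which exactly the stations of a set $\mathcal T$ transmit, station $u$ hears station $v$ if $v\in\mathcal T$, $u\notin\mathcal T$, $\mathrm{dist}(v,u)^{-\alpha}\ge 1+\varepsilon$ and $$\frac{\mathrm{dist}(v,u)^{-\alpha}}{1+\sum_{w\in\mathcal T\setminus\{v\}}\mathrm{dist}(w,u)^{-\alpha}}\ge 1.$$ Let $r=(1+\varepsilon)^{-1/\alpha}$ be the communication range. A station $v$ transmits successfully in a round if it transmits and every other station $u$ of the network with $\mathrm{dist}(v,u)\le r$ hears it. The pivotal grid divides the plane into the boxes $[i\gamma,(i+1)\gamma)\times[j\gamma,(j+1)\gamma)$, $(i,j)\in\mathbb Z^2$, with $\gamma=r/\sqrt2$. Schedules. A classical communication schedule of length $T$ is a map $[N]\to\{0,1\}^T$. For an integer $\delta\ge1$, an $(N,\delta)$-geometric communication schedule of length $L$ is a map $\mathcal S:[N]\times\{0,\dots,\delta-1\}^2\to\{0,1\}^L$;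 a station $v$ in box $(i,j)$ following it transmits in round $k$ iff the $k$-th bit of $\mathcal S(v,i\bmod\delta,j\bmod\delta)$ is $1$. The $\delta$-dilution of a classical schedule $\mathcal S_0$ of length $T$ is the $(N,\delta)$-geometric schedule of length $T\delta^2$ whose rounds are indexed by $(t,a,b)$, with $t$ a round of $\mathcal S_0$ and $0\le a,b<\delta$, ordered lexicographically, in which the bit of $(v,a',b')$ in round $(t,a,b)$ is $1$ iff $(a',b')=(a,b)$ and the $t$-th bit of $\mathcal S_0(v)$ is $1$. Selectors. An $(N,\delta)$-geometric schedule $\mathcal S$ is an $(N,\delta,\Delta,\eta)$-SINR-selector if for every network with identifiers in $[N]$ and every set $A$ of its stations with at most $\Delta$ elements in each box of the pivotal grid, when exactly the stations of $A$ follow $\mathcal S$: (a) at least $\eta|A|$ stations of $A$ transmit successfully in some round; (b) at least $\eta|B|$ stations of $B$ transmit successfully in some round, where $B$ is the set of those $v\in A$ whose box contains another element of $A$. Lemma. For all fixed $\alpha\ge2$ and $\varepsilon>0$ there is a constant $C>0$ such that for all natural numbers $N$ and $\Delta\le N$ there are an integer $\delta\ge1$ and an $(N,\delta,\Delta,1/2)$-SINR-selector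 which is the $\delta$-dilution of some classical communication schedule and for which, whenever $N\ge2$, $\delta\le C\log N$ and the length is at most $C\Delta\log^2N$ if $\alpha>2$, and at most $C\Delta\log^3N$ if $\alpha=2$. -/

import Mathlib

/-- The Euclidean plane. -/
abbrev Plane : Type := EuclideanSpace ℝ (Fin 2)

/-! ### The SINR model (uniform power `1`, threshold `1`, ambient noise `1`) -/

/-- The ratio `SINR(v, u, X)` for stations placed by `pos`, path loss `α`, transmitters `X`. -/
noncomputable def sinr (α : ℝ) {N : ℕ} (pos : Fin N → Plane) (v u : Fin N)
    (X : Finset (Fin N)) : ℝ :=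
  (1 / dist (pos v) (pos u) ^ α) /
    (1 + ∑ w ∈ X \ {v}, 1 / dist (pos w) (pos u) ^ α)

/-- Station `u` hears the message of `v` in a round in which exactly the stations of `X`
transmit; `ε` is the sensitivity parameter. -/
def Hears (α ε : ℝ) {N : ℕ} (pos : Fin N → Plane) (X : Finset (Fin N)) (v u : Fin N) : Prop :=
  v ∈ X ∧ u ∉ X ∧ 1 ≤ sinr α pos v u X ∧ 1 + ε ≤ dist (pos v) (pos u) ^ (-α)

/-- The communication range `r = (1 + ε) ^ (-1 / α)`. -/
noncomputable def commRange (α ε : ℝ) : ℝ := (1 + ε) ^ (-1 / α)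

/-- Station `v` transmits successfully in a round with transmitters `X`, in the network with
station set `V`: it transmits and every other station in its range hears it. -/
def TransmitsSuccessfully (α ε : ℝ) {N : ℕ} (V : Finset (Fin N)) (pos : Fin N → Plane)
    (X : Finset (Fin N)) (v : Fin N) : Prop :=
  v ∈ X ∧ ∀ u ∈ V, u ≠ v → dist (pos v) (pos u) ≤ commRange α ε → Hears α ε pos X v u

/-! ### Grids -/

/-- The grid coordinates of a point with respect to the grid `G_c`:
`i * c ≤ x < (i + 1) * c` and `j * c ≤ y < (j + 1) * c`. -/
noncomputable def gridCoord (c : ℝ) (p : Plane) : ℤ × ℤ := (⌊p 0 / c⌋, ⌊p 1 / c⌋)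

/-- The side `γ = r / √2` of the boxes of the pivotal grid. -/
noncomputable def pivotal (α ε : ℝ) : ℝ := commRange α ε / Real.sqrt 2

/-- The residue `i mod δ` in `{0, …, δ - 1}`. -/
def residue {δ : ℕ} (hδ : 0 < δ) (i : ℤ) : Fin δ := ⟨(i % (δ : ℤ)).toNat, by
  have h1 := Int.emod_lt_of_pos i (Int.natCast_pos.mpr hδ)
  have h2 := Int.emod_nonneg i (Int.natCast_pos.mpr hδ).ne'
  omega⟩

/-! ### Communication schedules -/

/-- Classical communication schedules of length `T` with respect to `N`. -/
abbrev Schedule (N T : ℕ) : Type := Fin N → Fin T → Bool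

/-- Geometric communication schedules, `(N, δ)`-gcs, of length `L`. -/
abbrev GeomSchedule (N δ L : ℕ) : Type := Fin N → Fin δ → Fin δ → Fin L → Bool

/-- The `δ`-dilution of a classical schedule. Rounds are counted from `0`: round
`t * δ ^ 2 + a * δ + b` of the dilution is the round `(t, a, b)`, in which only stations whose
grid coordinates are congruent to `(a, b)` modulo `δ` may transmit. -/
def dilution {N T : ℕ} (δ : ℕ) (S : Schedule N T) : GeomSchedule N δ (T * δ ^ 2) :=
  fun v a b k =>
    decide ((k : ℕ) % δ ^ 2 = (a : ℕ) * δ + (b : ℕ)) &&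
      S v ⟨(k : ℕ) / δ ^ 2, Nat.div_lt_of_lt_mul (k.isLt.trans_eq (Nat.mul_comm _ _))⟩

/-- The stations transmitting in round `k` when exactly the stations of `A` follow the
geometric schedule `S` for the grid `G_c`. -/
noncomputable def transmitters {N δ L : ℕ} (c : ℝ) (hδ : 0 < δ) (S : GeomSchedule N δ L)
    (pos : Fin N → Plane) (A : Finset (Fin N)) (k : Fin L) : Finset (Fin N) :=
  A.filter fun v =>
    S v (residue hδ (gridCoord c (pos v)).1) (residue hδ (gridCoord c (pos v)).2) k = true

/-- The stations of `A` sharing their box of the grid `G_c` with another station of `A`. -/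
noncomputable def sharing {N : ℕ} (c : ℝ) (pos : Fin N → Plane) (A : Finset (Fin N)) :
    Finset (Fin N) :=
  A.filter fun v => ∃ w ∈ A, w ≠ v ∧ gridCoord c (pos w) = gridCoord c (pos v)

open Classical in
/-- The stations of `D` that transmit successfully in some round of the execution of `S`
(on the pivotal grid) by the stations of `A`, in the network with station set `V`. -/
noncomputable def successful {N δ L : ℕ} (α ε : ℝ) (hδ : 0 < δ) (S : GeomSchedule N δ L)
    (V : Finset (Fin N)) (pos : Fin N → Plane) (A D : Finset (Fin N)) : Finset (Fin N) :=
  D.filter fun v => ∃ k : Fin L,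
    TransmitsSuccessfully α ε V pos (transmitters (pivotal α ε) hδ S pos A k) v

/-- `S` is an `(N, δ, Δ, η)`-SINR-selector. The network consists of any set `V` of stations
with identifiers among `N` and pairwise distinct positions; `A` is any set of stations with at
most `Δ` elements in each box of the pivotal grid. -/
def IsSINRSelector {N δ L : ℕ} (α ε : ℝ) (hδ : 0 < δ) (Δ : ℕ) (η : ℝ)
    (S : GeomSchedule N δ L) : Prop :=
  ∀ (V : Finset (Fin N)) (pos : Fin N → Plane), Set.InjOn pos (V : Set (Fin N)) →
    ∀ A : Finset (Fin N), A ⊆ V →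
      (∀ b : ℤ × ℤ, (A.filter fun v => gridCoord (pivotal α ε) (pos v) = b).card ≤ Δ) →
      η * (A.card : ℝ) ≤ ((successful α ε hδ S V pos A A).card : ℝ) ∧
      η * ((sharing (pivotal α ε) pos A).card : ℝ) ≤
        ((successful α ε hδ S V pos A (sharing (pivotal α ε) pos A)).card : ℝ)

/-! ### Random colourings -/

/-! The schedule comes from `k = O(log N)` random colourings of the identifiers with `2 ^ 16 * Δ`
colours. Round `(s, q)` belongs to colour `q` of the `s`-th colouring, and the result is diluted
with `δ ^ 2 = O(log N)`. This gives length `O(Δ log² N)` for every `α ≥ 2`, which is stronger than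
needed at `α = 2`.

Collisions: a union bound over exponential moments (`exists_colorings`) makes the average number of
collisions at most `|X| / 8` for all `X` of size at most `Δ` simultaneously. Applied box by box, at
most a quarter of the pairs (colouring, station of `D`) are not isolated, where `D` is either `A` or
the set of stations sharing a box.

Interference: an isolated station can fail only if the other transmitters produce interference above
`ε`. A box may hold many transmitters, so this is not bounded for each receiver but on average, by
double counting (`two_mul_card_le_of_interference`). In one colouring, a fixed `w` disturbs at most
one isolated station per box, so what it causes is a sum of inverse squares over distinct lattice
points, of order `log N / δ ^ 2`, and at most `ε / 8`. Hence at most a quarter of the pairs are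
isolated but disturbed, and at most half of `D` fails under every colouring. -/

theorem sum_sum_update {V β M : Type*} [Fintype V] [DecidableEq V] [Fintype β]
    [NonAssocSemiring M] (x : V) (h : (V → β) → M) :
    ∑ f : V → β, ∑ c : β, h (Function.update f x c) = Fintype.card β * ∑ f, h f := by
  classical
  have hinv : ∑ p : (V → β) × β, h (Function.update p.1 x p.2) = ∑ p : (V → β) × β, h p.1 := by
    -- Resampling the coordinate `x` preserves the counting measure: exchanging the old and the new
    -- value is an involution.
    let e : (V → β) × β → (V → β) × β := fun p => (Function.update p.1 x p.2, p.1 x)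
    have he : Function.Involutive e := by
      rintro ⟨f, c⟩
      simp [e]
    exact Fintype.sum_equiv he.toPerm _ _ fun p => rfl
  rw [← Fintype.sum_prod_type' (fun f c => h (Function.update f x c)), hinv,
    Fintype.sum_prod_type]
  simp [Finset.mul_sum]

/-- Exponential moment of the number of collisions of a uniformly random colouring on a set. -/
theorem sum_pow_collisions_le {V β : Type*} [Fintype V] [DecidableEq V] [Fintype β]
    [DecidableEq β] {W Δ : ℕ} (hW : 0 < W) (hβ : W * Δ ≤ Fintype.card β) (X : Finset V) :
    X.card ≤ Δ → ∑ f : V → β, W ^ (X.card - (X.image f).card) ≤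
      Fintype.card β ^ Fintype.card V * 2 ^ X.card := by
  induction X using Finset.induction_on with
  | empty => simp
  | insert x X hx ih =>
    intro hX
    rw [Finset.card_insert_of_notMem hx] at hX ⊢
    have ih := ih (by omega)
    have hq : 0 < Fintype.card β :=
      lt_of_lt_of_le (Nat.mul_pos hW (by omega)) hβ
    refine Nat.le_of_mul_le_mul_left ?_ hq
    have key := sum_sum_update (M := ℕ) x
      (fun f : V → β => W ^ (X.card + 1 - ((insert x X).image f).card))
    simp only [Nat.cast_id] at key
    rw [← key]
    have hstep : ∀ f : V → β,
        ∑ c : β, W ^ (X.card + 1 - ((insert x X).image (Function.update f x c)).card) ≤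
          W ^ (X.card - (X.image f).card) * (2 * Fintype.card β) := by
      intro f
      have himg : ∀ c, (insert x X).image (Function.update f x c) = insert c (X.image f) := by
        intro c
        rw [Finset.image_insert, Function.update_self]
        congr 1
        refine Finset.image_congr fun y hy => ?_
        rw [Function.update_of_ne]
        rintro rfl
        exact hx hy
      have hle : (X.image f).card ≤ X.card := Finset.card_image_le
      -- A reused colour costs a factor `W`, but fewer than `Δ` of the at least `W * Δ` colours are
      -- in use, so the average over `c` is at most 2.
      have hterm : ∀ c, W ^ (X.card + 1 - ((insert x X).image (Function.update f x c)).card) ≤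
          W ^ (X.card - (X.image f).card) * (1 + if c ∈ X.image f then W else 0) := by
        intro c
        rw [himg]
        split_ifs with hc
        · rw [Finset.insert_eq_of_mem hc, Nat.sub_add_comm hle, pow_succ]
          exact Nat.mul_le_mul_left _ (by omega)
        · rw [Finset.card_insert_of_notMem hc, Nat.add_sub_add_right]
          simp
      refine (Finset.sum_le_sum fun c _ => hterm c).trans ?_
      rw [← Finset.mul_sum]
      refine Nat.mul_le_mul_left _ ?_
      rw [Finset.sum_add_distrib]
      simp only [Finset.sum_const, Finset.card_univ, smul_eq_mul, mul_one, Finset.sum_ite_mem,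
        Finset.univ_inter]
      have : (X.image f).card * W ≤ W * Δ := by
        rw [mul_comm]
        exact Nat.mul_le_mul_left _ (by omega)
      omega
    refine (Finset.sum_le_sum fun f _ => hstep f).trans ?_
    rw [← Finset.sum_mul]
    calc _ ≤ (Fintype.card β ^ Fintype.card V * 2 ^ X.card) * (2 * Fintype.card β) :=
          Nat.mul_le_mul_right _ ih
      _ = _ := by ring

theorem one_add_inv_two_pow_pow_lt {n k : ℕ} (hk : 2 * n ≤ 2 ^ k) :
    (1 + (2 ^ k : ℝ)⁻¹) ^ n < 2 := by
  have h1 : (1 + (2 ^ k : ℝ)⁻¹) ^ n ≤ Real.exp ((2 ^ k : ℝ)⁻¹) ^ n := by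
    gcongr
    rw [add_comm]
    exact Real.add_one_le_exp _
  have h2 : (n : ℝ) * (2 ^ k : ℝ)⁻¹ ≤ 1 / 2 := by
    have : (2 * n : ℝ) ≤ 2 ^ k := by exact_mod_cast hk
    rw [← div_eq_mul_inv, div_le_iff₀ (by positivity)]
    linarith
  have h3 : Real.exp (1 / 2) < 2 := by
    rw [← Real.lt_log_iff_exp_lt (by norm_num)]
    linarith [Real.log_two_gt_d9]
  rw [← Real.exp_nat_mul] at h1
  exact h1.trans_lt ((Real.exp_le_exp.mpr h2).trans_lt h3)

/-- Logarithmically many colourings with `O(Δ)` colours have few collisions on all sets of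
size at most `Δ`. -/
theorem exists_colorings {V β : Type*} [Fintype V] [DecidableEq V] [Fintype β] [DecidableEq β]
    {Δ k : ℕ} (hβ : 2 ^ 16 * Δ ≤ Fintype.card β) (hβ0 : 0 < Fintype.card β)
    (hk : 2 * Fintype.card V ≤ 2 ^ k) :
    ∃ f : Fin k → V → β, ∀ X : Finset V, X.card ≤ Δ →
      8 * ∑ s, (X.card - (X.image (f s)).card) ≤ k * X.card := by
  by_contra! hbad
  set n := Fintype.card V
  set q := Fintype.card β
  set 𝒳 : Finset (Finset V) := Finset.univ.filter fun X => X.card ≤ Δ ∧ X ≠ ∅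
  let coll : (V → β) → Finset V → ℕ := fun f X => X.card - (X.image f).card
  -- A set `X` violating the bound has `2 * k * |X| < 16 * ∑ s, coll (F s) X`, so its term alone is
  -- at least 1.
  have hone : ∀ F : Fin k → V → β,
      (1 : ℝ) ≤ ∑ X ∈ 𝒳, (∏ s, (2 ^ 16 : ℝ) ^ coll (F s) X) * ((4 ^ k : ℝ)⁻¹) ^ X.card := by
    intro F
    obtain ⟨X, hX, hlt⟩ := hbad F
    have hX0 : X ≠ ∅ := by
      rintro rfl
      simp at hlt
    refine le_trans ?_ (Finset.single_le_sum (f := fun X => (∏ s, (2 ^ 16 : ℝ) ^ coll (F s) X) *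
      ((4 ^ k : ℝ)⁻¹) ^ X.card) (fun _ _ => by positivity)
      (Finset.mem_filter.mpr ⟨Finset.mem_univ X, hX, hX0⟩))
    rw [Finset.prod_pow_eq_pow_sum, inv_pow, ← div_eq_mul_inv, one_le_div (by positivity),
      ← pow_mul, ← pow_mul, show (4 : ℝ) = 2 ^ 2 by norm_num, ← pow_mul]
    refine pow_le_pow_right₀ (by norm_num) ?_
    change k * X.card < 8 * ∑ s, coll (F s) X at hlt
    omega
  -- On average over all families, a nonempty `X` weighs at most `(2 / 4) ^ (k * |X|)`. By the
  -- binomial theorem these weights sum to `(1 + 2 ^ (-k)) ^ n - 1 < 1`.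
  have htot : ((q : ℝ) ^ n) ^ k ≤ ((q : ℝ) ^ n) ^ k * ((1 + (2 ^ k : ℝ)⁻¹) ^ n - 1) := by
    calc ((q : ℝ) ^ n) ^ k = ∑ F : Fin k → V → β, (1 : ℝ) := by simp [n, q]
      _ ≤ ∑ F : Fin k → V → β, ∑ X ∈ 𝒳,
            (∏ s, (2 ^ 16 : ℝ) ^ coll (F s) X) * ((4 ^ k : ℝ)⁻¹) ^ X.card :=
          Finset.sum_le_sum fun F _ => hone F
      _ = ∑ X ∈ 𝒳, (∑ f : V → β, (2 ^ 16 : ℝ) ^ coll f X) ^ k * ((4 ^ k : ℝ)⁻¹) ^ X.card := by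
          rw [Finset.sum_comm]
          refine Finset.sum_congr rfl fun X _ => ?_
          rw [← Finset.sum_mul, Fintype.sum_pow]
      _ ≤ ∑ X ∈ 𝒳, ((q : ℝ) ^ n) ^ k * ((2 ^ k : ℝ)⁻¹) ^ X.card := by
          refine Finset.sum_le_sum fun X hX => ?_
          have hm : ∑ f : V → β, (2 ^ 16 : ℝ) ^ coll f X ≤ (q : ℝ) ^ n * 2 ^ X.card := by
            exact_mod_cast sum_pow_collisions_le (W := 2 ^ 16) (by norm_num) hβ X
              (Finset.mem_filter.mp hX).2.1
          calc _ ≤ ((q : ℝ) ^ n * 2 ^ X.card) ^ k * ((4 ^ k : ℝ)⁻¹) ^ X.card := by gcongr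
            _ = ((q : ℝ) ^ n) ^ k * (2 ^ k * (4 ^ k : ℝ)⁻¹) ^ X.card := by
                rw [mul_pow, mul_pow, ← pow_mul 2, ← pow_mul 2, mul_comm X.card k, mul_assoc]
            _ = _ := by
                congr 2
                rw [show (4 : ℝ) = 2 * 2 by norm_num, mul_pow]
                field_simp
      _ ≤ ∑ X ∈ (Finset.univ : Finset (Finset V)).erase ∅, ((q : ℝ) ^ n) ^ k * ((2 ^ k : ℝ)⁻¹) ^ X.card := by
          refine Finset.sum_le_sum_of_subset_of_nonneg (fun X hX => ?_)
            (fun _ _ _ => by positivity)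
          simp [(Finset.mem_filter.mp hX).2.2]
      _ = _ := by
          rw [← Finset.mul_sum, Finset.sum_erase_eq_sub (Finset.mem_univ _)]
          have := Fintype.sum_pow_mul_eq_add_pow V ((2 ^ k : ℝ)⁻¹) 1
          simp only [one_pow, mul_one] at this
          rw [this, add_comm (1 : ℝ)]
          simp [n]
  have hpos : (0 : ℝ) < ((q : ℝ) ^ n) ^ k := by
    have : (0 : ℝ) < q := by exact_mod_cast hβ0
    positivity
  nlinarith [one_add_inv_two_pow_pow_lt hk]

/-- A colour class of size `m ≥ 2` has `m` non-isolated points and `m - 1 ≥ m / 2` collisions; a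
singleton class has neither. -/
theorem card_not_isolated_le {V β : Type*} [DecidableEq V] [DecidableEq β] (f : V → β)
    (X : Finset V) :
    (X.filter fun v => ∃ w ∈ X, w ≠ v ∧ f w = f v).card ≤
      2 * (X.card - (X.image f).card) := by
  have hle : (X.image f).card ≤ X.card := Finset.card_image_le
  have hX := Finset.card_eq_sum_card_image f X
  have hF := Finset.card_eq_sum_card_fiberwise (f := f) (t := X.image f)
    (s := X.filter fun v => ∃ w ∈ X, w ≠ v ∧ f w = f v)
    (fun v hv => Finset.mem_coe.mpr (Finset.mem_image_of_mem f (Finset.mem_filter.mp hv).1))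
  suffices h : (X.filter fun v => ∃ w ∈ X, w ≠ v ∧ f w = f v).card + 2 * (X.image f).card ≤
      2 * X.card by omega
  rw [hF, hX, Finset.card_eq_sum_ones, Finset.mul_sum, Finset.mul_sum, ← Finset.sum_add_distrib]
  refine Finset.sum_le_sum fun c hc => ?_
  obtain ⟨x, hx, rfl⟩ := Finset.mem_image.mp hc
  have hxm : x ∈ X.filter fun v => f v = f x := by simp [hx]
  set Y := X.filter fun v => f v = f x with hY
  have hsub : ((X.filter fun v => ∃ w ∈ X, w ≠ v ∧ f w = f v).filter fun v => f v = f x) ⊆ Y :=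
    Finset.filter_subset_filter _ (Finset.filter_subset _ _)
  have hcard := Finset.card_le_card hsub
  have h1 : 0 < Y.card := Finset.card_pos.mpr ⟨x, hxm⟩
  by_cases h2 : 2 ≤ Y.card
  · omega
  · obtain ⟨y, hy⟩ := Finset.card_eq_one.mp (show Y.card = 1 by omega)
    have : ((X.filter fun v => ∃ w ∈ X, w ≠ v ∧ f w = f v).filter fun v => f v = f x) = ∅ := by
      refine Finset.filter_eq_empty_iff.mpr fun v hv hvx => ?_
      obtain ⟨hvX, w, hw, hwv, hfw⟩ := Finset.mem_filter.mp hv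
      have e1 : v ∈ Y := Finset.mem_filter.mpr ⟨hvX, hvx⟩
      have e2 : w ∈ Y := Finset.mem_filter.mpr ⟨hw, hfw.trans hvx⟩
      rw [hy, Finset.mem_singleton] at e1 e2
      exact hwv (e2.trans e1.symm)
    have h0 := congrArg Finset.card this
    rw [Finset.card_empty] at h0
    omega

/-! ### Geometry of the dilated grid -/

/-- The supremum norm on the integer lattice. -/
def latticeNorm (x : ℤ × ℤ) : ℕ := max x.1.natAbs x.2.natAbs

theorem latticeNorm_ne_zero {x : ℤ × ℤ} (hx : x ≠ 0) : latticeNorm x ≠ 0 := by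
  intro h
  apply hx
  unfold latticeNorm at h
  ext <;> simp <;> omega

/-- The shell of norm `j` has `8 * j` points, so norms up to `n` give a harmonic sum. The at most
`n` points further out contribute at most `1 / n` each, so the bound does not depend on the diameter
of `P`. -/
theorem sum_inv_latticeNorm_sq_le {n : ℕ} (P : Finset (ℤ × ℤ)) (h0 : (0 : ℤ × ℤ) ∉ P)
    (hP : P.card ≤ n) :
    ∑ x ∈ P, ((latticeNorm x : ℝ) ^ 2)⁻¹ ≤ 9 + 8 * Real.log n := by
  rw [← Finset.sum_filter_add_sum_filter_not P fun x => latticeNorm x ≤ n]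
  have hnear : ∑ x ∈ P with latticeNorm x ≤ n, ((latticeNorm x : ℝ) ^ 2)⁻¹ ≤
      8 * (1 + Real.log n) := by
    have hmap : ∀ x ∈ P.filter (fun x => latticeNorm x ≤ n), latticeNorm x ∈ Finset.Icc 1 n := by
      intro x hx
      rw [Finset.mem_filter] at hx
      have := latticeNorm_ne_zero (x := x) (by rintro rfl; exact h0 hx.1)
      rw [Finset.mem_Icc]
      omega
    rw [← Finset.sum_fiberwise_of_maps_to hmap]
    calc _ ≤ ∑ j ∈ Finset.Icc 1 n, 8 * ((j : ℝ)⁻¹) := by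
          refine Finset.sum_le_sum fun j hj => ?_
          have hj1 := (Finset.mem_Icc.mp hj).1
          have hj0 : (0 : ℝ) < j := by exact_mod_cast hj1
          calc _ ≤ ∑ x ∈ (Finset.box j : Finset (ℤ × ℤ)), ((j : ℝ) ^ 2)⁻¹ := by
                rw [Finset.sum_congr rfl (g := fun _ => ((j : ℝ) ^ 2)⁻¹)
                  (fun x hx => by rw [(Finset.mem_filter.mp hx).2])]
                refine Finset.sum_le_sum_of_subset_of_nonneg (fun x hx => ?_)
                  (fun _ _ _ => by positivity)
                exact Int.mem_box.mpr (Finset.mem_filter.mp hx).2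
            _ = 8 * (j : ℝ)⁻¹ := by
                rw [Finset.sum_const, Int.card_box (by omega), nsmul_eq_mul]
                push_cast
                field_simp
      _ = 8 * (harmonic n : ℝ) := by
          rw [← Finset.mul_sum, harmonic_eq_sum_Icc]
          push_cast
          rfl
      _ ≤ _ := by
          gcongr
          exact harmonic_le_one_add_log n
  have hfar : ∑ x ∈ P with ¬ latticeNorm x ≤ n, ((latticeNorm x : ℝ) ^ 2)⁻¹ ≤ 1 := by
    rcases Nat.eq_zero_or_pos n with rfl | hn
    · have : P = ∅ := Finset.card_eq_zero.mp (by omega)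
      simp [this]
    have hn' : (1 : ℝ) ≤ n := by exact_mod_cast hn
    calc _ ≤ ∑ x ∈ P with ¬ latticeNorm x ≤ n, (n : ℝ)⁻¹ := by
          refine Finset.sum_le_sum fun x hx => ?_
          have hx : (n : ℝ) ≤ latticeNorm x := by
            exact_mod_cast (not_le.mp (Finset.mem_filter.mp hx).2).le
          gcongr
          nlinarith
      _ ≤ n * (n : ℝ)⁻¹ := by
          rw [Finset.sum_const, nsmul_eq_mul]
          gcongr
          exact (Finset.card_filter_le _ _).trans hP
      _ = 1 := by field_simp
  linarith

theorem residue_eq_iff {δ : ℕ} (hδ : 0 < δ) {i j : ℤ} :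
    residue hδ i = residue hδ j ↔ (δ : ℤ) ∣ i - j := by
  have hδ' : (δ : ℤ) ≠ 0 := by omega
  have h1 := Int.emod_nonneg i hδ'
  have h2 := Int.emod_nonneg j hδ'
  rw [residue, residue, Fin.mk.injEq, Int.dvd_iff_emod_eq_zero,
    ← Int.emod_eq_emod_iff_emod_sub_eq_zero]
  omega

/-- The boxes `b` and `b'` lie in the same class of the `δ`-dilution. -/
def SameClass (δ : ℕ) (b b' : ℤ × ℤ) : Prop :=
  (δ : ℤ) ∣ b.1 - b'.1 ∧ (δ : ℤ) ∣ b.2 - b'.2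

theorem SameClass.symm {δ : ℕ} {b b' : ℤ × ℤ} (h : SameClass δ b b') : SameClass δ b' b :=
  ⟨by simpa using h.1.neg_right, by simpa using h.2.neg_right⟩

theorem SameClass.le_latticeNorm {δ : ℕ} {b b' : ℤ × ℤ} (h : SameClass δ b b') (hne : b ≠ b') :
    δ ≤ latticeNorm (b - b') := by
  unfold latticeNorm
  by_cases h1 : b.1 - b'.1 = 0
  · have h2 : b.2 - b'.2 ≠ 0 := fun h2 => hne (Prod.ext (by omega) (by omega))
    have := Int.natAbs_le_of_dvd_ne_zero h.2 h2
    simp at this ⊢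
    omega
  · have := Int.natAbs_le_of_dvd_ne_zero h.1 h1
    simp at this ⊢
    omega

/-- An upper bound for the interference caused at the receivers of a station in box `b'` by a
station in box `b`. -/
noncomputable def boxInterference (c : ℝ) (b b' : ℤ × ℤ) : ℝ :=
  4 / c ^ 2 * ((latticeNorm (b - b') : ℝ) ^ 2)⁻¹

theorem boxInterference_comm (c : ℝ) (b b' : ℤ × ℤ) :
    boxInterference c b b' = boxInterference c b' b := by
  have : latticeNorm (b - b') = latticeNorm (b' - b) := by
    simp only [latticeNorm, Prod.fst_sub, Prod.snd_sub]
    omega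
  rw [boxInterference, boxInterference, this]

/-- Dividing the offsets from `b` by `δ` gives distinct nonzero lattice points; the rescaling gains
the factor `δ ^ (-2)`. -/
theorem sum_boxInterference_le {ι : Type*} {c : ℝ} {δ n : ℕ} (hδ : 0 < δ) (P : Finset ι)
    (hP : P.card ≤ n) (box : ι → ℤ × ℤ) (b : ℤ × ℤ) (hinj : Set.InjOn box P)
    (hclass : ∀ v ∈ P, SameClass δ (box v) b) (hne : ∀ v ∈ P, box v ≠ b) :
    ∑ v ∈ P, boxInterference c (box v) b ≤ 4 / (c ^ 2 * δ ^ 2) * (9 + 8 * Real.log n) := by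
  have hδ' : (δ : ℤ) ≠ 0 := by omega
  let q : ι → ℤ × ℤ := fun v => (((box v).1 - b.1) / δ, ((box v).2 - b.2) / δ)
  have hq1 : ∀ v ∈ P, (box v).1 - b.1 = δ * (q v).1 := fun v hv =>
    (Int.mul_ediv_cancel' (hclass v hv).1).symm
  have hq2 : ∀ v ∈ P, (box v).2 - b.2 = δ * (q v).2 := fun v hv =>
    (Int.mul_ediv_cancel' (hclass v hv).2).symm
  have hnorm : ∀ v ∈ P, latticeNorm (box v - b) = δ * latticeNorm (q v) := by
    intro v hv
    simp only [latticeNorm, Prod.fst_sub, Prod.snd_sub, hq1 v hv, hq2 v hv, Int.natAbs_mul,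
      Int.natAbs_natCast]
    rw [Nat.mul_max_mul_left]
  have hqinj : Set.InjOn q P := by
    intro v hv w hw h
    refine hinj hv hw (Prod.ext ?_ ?_)
    · have := hq1 v hv
      have := hq1 w hw
      rw [h] at *
      omega
    · have := hq2 v hv
      have := hq2 w hw
      rw [h] at *
      omega
  have hq0 : (0 : ℤ × ℤ) ∉ P.image q := by
    intro h
    obtain ⟨v, hv, hqv⟩ := Finset.mem_image.mp h
    have h1 := hq1 v hv
    have h2 := hq2 v hv
    rw [hqv] at h1 h2
    simp at h1 h2
    exact hne v hv (Prod.ext (by omega) (by omega))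
  have hsum := sum_inv_latticeNorm_sq_le (n := n) (P.image q) hq0
    (Finset.card_image_le.trans hP)
  rw [Finset.sum_image hqinj] at hsum
  calc _ = ∑ v ∈ P, 4 / (c ^ 2 * δ ^ 2) * ((latticeNorm (q v) : ℝ) ^ 2)⁻¹ := by
        refine Finset.sum_congr rfl fun v hv => ?_
        rw [boxInterference, hnorm v hv]
        push_cast
        rw [mul_pow, mul_inv, div_eq_mul_inv, div_eq_mul_inv, mul_inv]
        ring
    _ ≤ _ := by
        rw [← Finset.mul_sum]
        gcongr

/-! ### Distances and path loss between boxes of one class -/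

theorem commRange_pos {α ε : ℝ} (hε : 0 < ε) : 0 < commRange α ε :=
  Real.rpow_pos_of_pos (by linarith) _

theorem pivotal_pos {α ε : ℝ} (hε : 0 < ε) : 0 < pivotal α ε :=
  div_pos (commRange_pos hε) (by positivity)

theorem commRange_le_pivotal {α ε : ℝ} (hε : 0 < ε) :
    commRange α ε ≤ 3 / 2 * pivotal α ε := by
  have h1 : commRange α ε = pivotal α ε * Real.sqrt 2 := by
    rw [pivotal, div_mul_cancel₀]
    positivity
  have h2 : Real.sqrt 2 ≤ 3 / 2 := by
    rw [Real.sqrt_le_left (by norm_num)]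
    norm_num
  rw [h1]
  nlinarith [pivotal_pos (α := α) hε]

theorem abs_coord_sub_le_dist (p q : Plane) (i : Fin 2) : |p i - q i| ≤ dist p q := by
  rw [dist_eq_norm]
  exact PiLp.norm_apply_le (p - q) i

theorem natAbs_floor_sub_le {c x y : ℝ} (hc : 0 < c) :
    (((⌊x / c⌋ - ⌊y / c⌋).natAbs : ℝ) - 1) * c ≤ |x - y| := by
  have hdiv : |x - y| = |x / c - y / c| * c := by
    rw [← sub_div, abs_div, abs_of_pos hc, div_mul_cancel₀ _ hc.ne']
  rw [hdiv]
  refine mul_le_mul_of_nonneg_right ?_ hc.le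
  have h1 := Int.floor_le (x / c)
  have h2 := Int.lt_floor_add_one (x / c)
  have h3 := Int.floor_le (y / c)
  have h4 := Int.lt_floor_add_one (y / c)
  rw [Nat.cast_natAbs, Int.cast_abs, Int.cast_sub]
  rcases abs_cases ((⌊x / c⌋ : ℝ) - ⌊y / c⌋) with h | h <;>
  rcases abs_cases (x / c - y / c) with h' | h' <;> linarith

theorem latticeNorm_gridCoord_le_dist {c : ℝ} (hc : 0 < c) (p q : Plane) :
    ((latticeNorm (gridCoord c p - gridCoord c q) : ℝ) - 1) * c ≤ dist p q := by
  unfold latticeNorm gridCoord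
  rcases max_choice (⌊p 0 / c⌋ - ⌊q 0 / c⌋).natAbs (⌊p 1 / c⌋ - ⌊q 1 / c⌋).natAbs with h | h
  · simp only [Prod.mk_sub_mk, h]
    exact (natAbs_floor_sub_le hc).trans (abs_coord_sub_le_dist p q 0)
  · simp only [Prod.mk_sub_mk, h]
    exact (natAbs_floor_sub_le hc).trans (abs_coord_sub_le_dist p q 1)

/-- For boxes at lattice distance `H`, `w` is at least `(H - 1) * γ` from `v` while `u` is within `3
/ 2 * γ` of `v`; and `H - 5 / 2 ≥ H / 2` because `H ≥ δ ≥ 5`. -/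
theorem le_dist_of_sameClass {α ε : ℝ} (hε : 0 < ε) {δ : ℕ} (hδ5 : 5 ≤ δ) {v w u : Plane}
    (hclass : SameClass δ (gridCoord (pivotal α ε) w) (gridCoord (pivotal α ε) v))
    (hne : gridCoord (pivotal α ε) w ≠ gridCoord (pivotal α ε) v)
    (hu : dist v u ≤ commRange α ε) :
    pivotal α ε * latticeNorm (gridCoord (pivotal α ε) w - gridCoord (pivotal α ε) v) / 2 ≤
      dist w u := by
  have hc := pivotal_pos (α := α) hε
  have h1 := latticeNorm_gridCoord_le_dist hc w v
  have h2 : (5 : ℝ) ≤ latticeNorm (gridCoord (pivotal α ε) w - gridCoord (pivotal α ε) v) := by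
    exact_mod_cast hδ5.trans (hclass.le_latticeNorm hne)
  have h3 := dist_triangle_right w v u
  have h4 := commRange_le_pivotal (α := α) hε
  nlinarith

/-- The condition `2 ≤ γ * δ` puts interferers at distance at least 1, where the exponent `α` may be
lowered to 2. -/
theorem inv_dist_rpow_le_boxInterference {α ε : ℝ} (hα : 2 ≤ α) (hε : 0 < ε) {δ : ℕ}
    (hδ5 : 5 ≤ δ) (hδγ : 2 ≤ pivotal α ε * δ) {v w u : Plane}
    (hclass : SameClass δ (gridCoord (pivotal α ε) w) (gridCoord (pivotal α ε) v))
    (hne : gridCoord (pivotal α ε) w ≠ gridCoord (pivotal α ε) v)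
    (hu : dist v u ≤ commRange α ε) :
    1 / dist w u ^ α ≤
      boxInterference (pivotal α ε) (gridCoord (pivotal α ε) w) (gridCoord (pivotal α ε) v) := by
  have hc := pivotal_pos (α := α) hε
  have hd := le_dist_of_sameClass hε hδ5 hclass hne hu
  have hH : (δ : ℝ) ≤ latticeNorm (gridCoord (pivotal α ε) w - gridCoord (pivotal α ε) v) := by
    exact_mod_cast hclass.le_latticeNorm hne
  rw [boxInterference]
  set H : ℝ := ((latticeNorm (gridCoord (pivotal α ε) w - gridCoord (pivotal α ε) v) : ℕ) : ℝ)
  set γ := pivotal α ε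
  have hγH : 1 ≤ γ * H / 2 := by nlinarith
  have hH0 : 0 < H := by
    have : (5 : ℝ) ≤ δ := by exact_mod_cast hδ5
    linarith
  calc 1 / dist w u ^ α ≤ 1 / dist w u ^ (2 : ℝ) := by
        have : 1 ≤ dist w u := hγH.trans hd
        gcongr
    _ ≤ 1 / (γ * H / 2) ^ 2 := by
        rw [Real.rpow_two]
        gcongr
    _ = _ := by
        field_simp
        norm_num

/-! ### Isolated stations and interference -/

/-- No other element of `A` in the box of `v` has the colour of `v`. -/
def Isolated {ι β : Type*} (A : Finset ι) (box : ι → ℤ × ℤ) (f : ι → β) (v : ι) : Prop :=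
  ∀ w ∈ A, box w = box v → f w = f v → w = v

open Classical in
-- By `hD`, a box meeting `D` has all its elements of `A` in `D`, so the collision bound applies in
-- each box separately. Each collision accounts for at most two non-isolated stations, which turns 8
-- into 4.
theorem card_not_isolated_sum_le {ι β : Type*} [DecidableEq ι] [DecidableEq β] {k Δ : ℕ} {f : Fin k → ι → β}
    (hf : ∀ X : Finset ι, X.card ≤ Δ →
      8 * ∑ s, (X.card - (X.image (f s)).card) ≤ k * X.card)
    {A D : Finset ι} (hDA : D ⊆ A) {box : ι → ℤ × ℤ}
    (hA : ∀ b, (A.filter fun v => box v = b).card ≤ Δ)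
    (hD : ∀ v ∈ D, ∀ w ∈ A, box w = box v → w ∈ D) :
    4 * ∑ s, (D.filter fun v => ¬ Isolated A box (f s) v).card ≤ k * D.card := by
  let X : ℤ × ℤ → Finset ι := fun b => D.filter fun v => box v = b
  have hbox : ∀ s, (D.filter fun v => ¬ Isolated A box (f s) v).card ≤
      ∑ b ∈ D.image box, 2 * ((X b).card - ((X b).image (f s)).card) := by
    intro s
    rw [Finset.card_eq_sum_card_fiberwise (f := box) (t := D.image box)
      (fun v hv => Finset.mem_coe.mpr (Finset.mem_image_of_mem box (Finset.mem_filter.mp hv).1))]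
    refine Finset.sum_le_sum fun b _ => le_trans (Finset.card_le_card fun v hv => ?_)
      (card_not_isolated_le (f s) (X b))
    obtain ⟨hvF, rfl⟩ := Finset.mem_filter.mp hv
    obtain ⟨hvD, hviso⟩ := Finset.mem_filter.mp hvF
    unfold Isolated at hviso
    push Not at hviso
    obtain ⟨w, hw, hwv, hfw, hne⟩ := hviso
    exact Finset.mem_filter.mpr ⟨Finset.mem_filter.mpr ⟨hvD, rfl⟩, w,
      Finset.mem_filter.mpr ⟨hD v hvD w hw hwv, hwv⟩, hne, hfw⟩
  calc 4 * ∑ s, (D.filter fun v => ¬ Isolated A box (f s) v).card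
      ≤ 4 * ∑ s, ∑ b ∈ D.image box, 2 * ((X b).card - ((X b).image (f s)).card) :=
        Nat.mul_le_mul_left _ (Finset.sum_le_sum fun s _ => hbox s)
    _ = ∑ b ∈ D.image box, 8 * ∑ s, ((X b).card - ((X b).image (f s)).card) := by
        rw [Finset.sum_comm, Finset.mul_sum]
        refine Finset.sum_congr rfl fun b _ => ?_
        rw [← Finset.mul_sum]
        ring
    _ ≤ ∑ b ∈ D.image box, k * (X b).card := by
        refine Finset.sum_le_sum fun b _ => hf _ ?_
        exact (Finset.card_le_card (Finset.filter_subset_filter _ hDA)).trans (hA b)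
    _ = k * D.card := by
        rw [← Finset.mul_sum, Finset.card_eq_sum_card_image box D]

open Classical in
/-- If few pairs of stations and colourings are not isolated, then at most half of the stations
suffer from large interference whenever they are isolated. -/
theorem two_mul_card_le_of_interference {ι β : Type*} [DecidableEq ι] [DecidableEq β]
    {k δ : ℕ} (hk : 0 < k) (f : Fin k → ι → β) {A D F : Finset ι} (hDA : D ⊆ A) (hFD : F ⊆ D) {box : ι → ℤ × ℤ}
    (hsingle : ∀ v ∈ A, v ∉ D → ∀ w ∈ A, box w = box v → w = v)
    (hiso : 4 * ∑ s, (D.filter fun v => ¬ Isolated A box (f s) v).card ≤ k * D.card)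
    {c ε : ℝ} (hε : 0 < ε)
    (hG : ∀ P ⊆ A, ∀ b, Set.InjOn box P → (∀ v ∈ P, SameClass δ (box v) b) →
      (∀ v ∈ P, box v ≠ b) → ∑ v ∈ P, boxInterference c (box v) b ≤ ε / 8)
    (hF : ∀ v ∈ F, ∀ s, Isolated A box (f s) v →
      ε < ∑ w ∈ A with (SameClass δ (box w) (box v) ∧ f s w = f s v) ∧ w ≠ v,
        boxInterference c (box w) (box v)) :
    2 * F.card ≤ D.card := by
  by_contra! hlt
  let I : ι → ι → ℝ := fun w v => boxInterference c (box w) (box v)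
  let rel : Fin k → ι → ι → Prop := fun s w v =>
    (SameClass δ (box w) (box v) ∧ f s w = f s v) ∧ w ≠ v
  let E : Fin k → Finset ι := fun s => F.filter fun v => Isolated A box (f s) v
  -- Stations of `A \ D` are alone in their boxes, so together they contribute at most `ε / 8`; the
  -- rest of the interference comes from `D`.
  have hlow : ∀ s, ∀ v ∈ E s, ε / 2 ≤ ∑ w ∈ D with rel s w v, I w v := by
    intro s v hv
    obtain ⟨hvF, hviso⟩ := Finset.mem_filter.mp hv
    have htot := hF v hvF s hviso
    have hsplit : ∑ w ∈ A with rel s w v, I w v =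
        ∑ w ∈ D with rel s w v, I w v + ∑ w ∈ A \ D with rel s w v, I w v := by
      rw [← Finset.sum_union (Finset.disjoint_filter_filter Finset.disjoint_sdiff),
        ← Finset.filter_union, Finset.union_sdiff_of_subset hDA]
    have hrest : ∑ w ∈ A \ D with rel s w v, I w v ≤ ε / 8 := by
      have hmem : ∀ w ∈ (A \ D).filter fun w => rel s w v, w ∈ A ∧ w ∉ D ∧ rel s w v := by
        intro w hw
        simpa [and_assoc] using hw
      refine hG _ (fun w hw => (hmem w hw).1) (box v) ?_ ?_ ?_
      · intro w hw w' hw' h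
        exact hsingle w' (hmem w' hw').1 (hmem w' hw').2.1 w (hmem w hw).1 h
      · exact fun w hw => (hmem w hw).2.2.1.1
      · intro w hw h
        exact (hmem w hw).2.2.2 (hsingle w (hmem w hw).1 (hmem w hw).2.1 v
          (hDA (hFD hvF)) h.symm).symm
    change ε < ∑ w ∈ A with rel s w v, I w v at htot
    linarith
  -- With the sums exchanged, the stations of `E s` sharing the colour of a fixed `w` lie in
  -- distinct boxes by isolation, so `hG` applies around `w`.
  have hup : ∀ s, ∑ v ∈ E s, ∑ w ∈ D with rel s w v, I w v ≤ D.card * (ε / 8) := by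
    intro s
    simp only [Finset.sum_filter]
    rw [Finset.sum_comm, ← nsmul_eq_mul]
    refine Finset.sum_le_card_nsmul _ _ _ fun w hw => ?_
    rw [← Finset.sum_filter]
    have hmem : ∀ v ∈ (E s).filter fun v => rel s w v,
        v ∈ A ∧ Isolated A box (f s) v ∧ rel s w v := by
      intro v hv
      obtain ⟨hvE, hrel⟩ := Finset.mem_filter.mp hv
      obtain ⟨hvF, hviso⟩ := Finset.mem_filter.mp hvE
      exact ⟨hDA (hFD hvF), hviso, hrel⟩
    rw [Finset.sum_congr rfl fun v _ => boxInterference_comm c (box w) (box v)]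
    refine hG _ (fun v hv => (hmem v hv).1) (box w) ?_ ?_ ?_
    · intro v hv v' hv' h
      exact (hmem v' hv').2.1 v (hmem v hv).1 h
        ((hmem v hv).2.2.1.2.symm.trans (hmem v' hv').2.2.1.2)
    · exact fun v hv => (hmem v hv).2.2.1.1.symm
    · intro v hv h
      obtain ⟨-, hviso, ⟨-, hfw⟩, hne⟩ := hmem v hv
      exact hne (hviso w (hDA hw) h.symm hfw)
  -- More than `k * |D| / 2` pairs would fail, at most a quarter of `k * |D|` through lack of
  -- isolation. The rest, more than a quarter, receive at least `ε / 2` each, exceeding the total `k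
  -- * |D| * ε / 8`.
  have hcard : k * F.card ≤
      ∑ s, (E s).card + ∑ s, (D.filter fun v => ¬ Isolated A box (f s) v).card := by
    rw [← Finset.sum_add_distrib]
    have : k * F.card = ∑ _s : Fin k, F.card := by simp
    rw [this]
    refine Finset.sum_le_sum fun s _ => ?_
    rw [← Finset.card_filter_add_card_filter_not (s := F) fun v => Isolated A box (f s) v]
    exact Nat.add_le_add_left (Finset.card_le_card (Finset.filter_subset_filter _ hFD)) _
  have hE : k * D.card < 4 * ∑ s, (E s).card := by
    have : k * D.card < k * (2 * F.card) := Nat.mul_lt_mul_of_pos_left hlt hk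
    nlinarith
  have h1 : (∑ s, (E s).card : ℕ) * (ε / 2) ≤ ∑ s, ∑ v ∈ E s, ∑ w ∈ D with rel s w v, I w v := by
    rw [Nat.cast_sum, Finset.sum_mul]
    refine Finset.sum_le_sum fun s _ => ?_
    rw [← nsmul_eq_mul]
    exact Finset.card_nsmul_le_sum _ _ _ (hlow s)
  have h2 : ∑ s, ∑ v ∈ E s, ∑ w ∈ D with rel s w v, I w v ≤ k * (D.card * (ε / 8)) := by
    refine (Finset.sum_le_sum fun s _ => hup s).trans ?_
    simp
  have h3 : (k * D.card : ℝ) < 4 * (∑ s, (E s).card : ℕ) := by exact_mod_cast hE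
  nlinarith

/-! ### The schedule of a family of colourings -/

/-- The classical schedule with rounds `(s, q)` in which the stations of colour `q` under the
`s`-th colouring transmit. -/
def coloringSchedule {N k Q : ℕ} (f : Fin k → Fin N → Fin Q) : Schedule N (k * Q) :=
  fun v t => decide (f (finProdFinEquiv.symm t).1 v = (finProdFinEquiv.symm t).2)

theorem exists_dilution_round {N T δ : ℕ} (S : Schedule N T) (t : Fin T) (a b : Fin δ) :
    ∃ κ : Fin (T * δ ^ 2), ∀ v a' b',
      dilution δ S v a' b' κ = true ↔ a' = a ∧ b' = b ∧ S v t = true := by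
  have hlt : ∀ a b : Fin δ, (a : ℕ) * δ + b < δ ^ 2 := by
    intro a b
    have ha := a.isLt
    have hb := b.isLt
    nlinarith
  have hab := hlt a b
  have hκ : (t : ℕ) * δ ^ 2 + (a * δ + b) < T * δ ^ 2 := by
    have ht := t.isLt
    nlinarith
  refine ⟨⟨(t : ℕ) * δ ^ 2 + (a * δ + b), hκ⟩, fun v a' b' => ?_⟩
  have hmod : ((t : ℕ) * δ ^ 2 + (a * δ + b)) % δ ^ 2 = a * δ + b := by
    rw [mul_comm, Nat.mul_add_mod, Nat.mod_eq_of_lt hab]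
  have hdiv : ((t : ℕ) * δ ^ 2 + (a * δ + b)) / δ ^ 2 = t := by
    rw [mul_comm, Nat.mul_add_div (by omega), Nat.div_eq_of_lt hab, add_zero]
  simp only [dilution, hmod, hdiv, Bool.and_eq_true, decide_eq_true_eq, Fin.eta]
  rw [← and_assoc]
  refine and_congr_left fun _ => ⟨fun h => ?_, fun h => by rw [h.1, h.2]⟩
  have hδ : 0 < δ := a.pos
  have h1 := congrArg (· / δ) h
  have h2 := congrArg (· % δ) h
  simp only [mul_comm _ δ, Nat.mul_add_div hδ, Nat.div_eq_of_lt (Fin.isLt _), Nat.mul_add_mod,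
    Nat.mod_eq_of_lt (Fin.isLt _), add_zero] at h1 h2
  exact ⟨Fin.ext h1.symm, Fin.ext h2.symm⟩

open Classical in
theorem exists_transmitters_eq {N k Q δ : ℕ} (hδ : 0 < δ) (f : Fin k → Fin N → Fin Q) (c : ℝ)
    (pos : Fin N → Plane) (A : Finset (Fin N)) (v : Fin N) (s : Fin k) :
    ∃ κ, transmitters c hδ (dilution δ (coloringSchedule f)) pos A κ =
      A.filter fun w => SameClass δ (gridCoord c (pos w)) (gridCoord c (pos v)) ∧
        f s w = f s v := by
  obtain ⟨κ, hκ⟩ := exists_dilution_round (coloringSchedule f) (finProdFinEquiv (s, f s v))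
    (residue hδ (gridCoord c (pos v)).1) (residue hδ (gridCoord c (pos v)).2)
  refine ⟨κ, Finset.filter_congr fun w _ => ?_⟩
  rw [hκ, residue_eq_iff, residue_eq_iff, ← and_assoc]
  simp [SameClass, coloringSchedule]

open Classical in
-- Noise plus interference is at most `1 + ε`, exactly the signal strength guaranteed within the
-- communication range.
theorem transmitsSuccessfully_of_isolated {N δ : ℕ} {α ε : ℝ} (hα : 2 ≤ α) (hε : 0 < ε)
    (hδ5 : 5 ≤ δ) (hδγ : 2 ≤ pivotal α ε * δ) {V A : Finset (Fin N)} {pos : Fin N → Plane}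
    (hpos : Set.InjOn pos (V : Set (Fin N))) (hAV : A ⊆ V) {v : Fin N} (hv : v ∈ A)
    {β : Type*} [DecidableEq β] (f : Fin N → β)
    (hiso : Isolated A (fun w => gridCoord (pivotal α ε) (pos w)) f v)
    (hint : ∑ w ∈ A with (SameClass δ (gridCoord (pivotal α ε) (pos w))
        (gridCoord (pivotal α ε) (pos v)) ∧ f w = f v) ∧ w ≠ v,
      boxInterference (pivotal α ε) (gridCoord (pivotal α ε) (pos w))
        (gridCoord (pivotal α ε) (pos v)) ≤ ε) :
    TransmitsSuccessfully α ε V pos (A.filter fun w => SameClass δ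
      (gridCoord (pivotal α ε) (pos w)) (gridCoord (pivotal α ε) (pos v)) ∧ f w = f v) v := by
  set box : Fin N → ℤ × ℤ := fun w => gridCoord (pivotal α ε) (pos w) with hbox
  have hvX : v ∈ A.filter fun w => SameClass δ (box w) (box v) ∧ f w = f v :=
    Finset.mem_filter.mpr ⟨hv, by simp [SameClass], rfl⟩
  have hne : ∀ w ∈ A, f w = f v → w ≠ v → box w ≠ box v := fun w hw hfw hwv h =>
    hwv (hiso w hw h hfw)
  refine ⟨hvX, fun u hu huv hd => ?_⟩
  have hd0 : 0 < dist (pos v) (pos u) := dist_pos.mpr fun h => huv (hpos hu (hAV hv) h.symm)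
  have hsens : 1 + ε ≤ dist (pos v) (pos u) ^ (-α) := by
    calc 1 + ε = commRange α ε ^ (-α) := by
          rw [commRange, ← Real.rpow_mul (by linarith), neg_div, neg_mul_neg, one_div,
            inv_mul_cancel₀ (by linarith), Real.rpow_one]
      _ ≤ _ := Real.rpow_le_rpow_of_nonpos hd0 hd (by linarith)
  refine ⟨hvX, fun huX => ?_, ?_, hsens⟩
  -- A transmitting `u` would lie in a different box of the class, and the distance bound with `w =
  -- u` would make its distance to itself positive.
  · obtain ⟨huA, hclass, hfu⟩ := Finset.mem_filter.mp huX
    have h1 := le_dist_of_sameClass (v := pos v) (u := pos u) hε hδ5 hclass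
      (hne u huA hfu huv) hd
    have h2 : (5 : ℝ) ≤ latticeNorm (box u - box v) := by
      exact_mod_cast hδ5.trans (hclass.le_latticeNorm (hne u huA hfu huv))
    rw [dist_self] at h1
    nlinarith [pivotal_pos (α := α) hε]
  · rw [sinr, one_le_div]
    · refine le_trans (add_le_add_right ?_ 1) (hsens.trans ?_)
      · refine le_trans ?_ hint
        have : (A.filter fun w => SameClass δ (box w) (box v) ∧ f w = f v) \ {v} =
            A.filter fun w => (SameClass δ (box w) (box v) ∧ f w = f v) ∧ w ≠ v := by
          ext w
          simp [and_assoc]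
        rw [this]
        refine Finset.sum_le_sum fun w hw => ?_
        obtain ⟨hwA, ⟨hclass, hfw⟩, hwv⟩ := Finset.mem_filter.mp hw
        exact inv_dist_rpow_le_boxInterference hα hε hδ5 hδγ hclass (hne w hwA hfw hwv) hd
      · rw [Real.rpow_neg hd0.le, one_div]
    · have : 0 ≤ ∑ w ∈ (A.filter fun w => SameClass δ (box w) (box v) ∧ f w = f v) \ {v},
          1 / dist (pos w) (pos u) ^ α := Finset.sum_nonneg fun _ _ => by positivity
      linarith

/-- The hypothesis `hsingle` lets one argument serve both selector properties: it is vacuous for `D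
= A` and holds by definition for the sharing stations. -/
theorem half_card_le_successful {N k Q δ Δ : ℕ} {α ε : ℝ} (hα : 2 ≤ α) (hε : 0 < ε)
    (hδ : 0 < δ) (hδ5 : 5 ≤ δ) (hδγ : 2 ≤ pivotal α ε * δ)
    (hG : 4 / (pivotal α ε ^ 2 * δ ^ 2) * (9 + 8 * Real.log N) ≤ ε / 8)
    (hk : 0 < k) {f : Fin k → Fin N → Fin Q}
    (hf : ∀ X : Finset (Fin N), X.card ≤ Δ →
      8 * ∑ s, (X.card - (X.image (f s)).card) ≤ k * X.card)
    {V A D : Finset (Fin N)} {pos : Fin N → Plane} (hpos : Set.InjOn pos (V : Set (Fin N)))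
    (hAV : A ⊆ V) (hA : ∀ b, (A.filter fun v => gridCoord (pivotal α ε) (pos v) = b).card ≤ Δ)
    (hDA : D ⊆ A) (hsingle : ∀ v ∈ A, v ∉ D → ∀ w ∈ A,
      gridCoord (pivotal α ε) (pos w) = gridCoord (pivotal α ε) (pos v) → w = v) :
    1 / 2 * (D.card : ℝ) ≤
      ((successful α ε hδ (dilution δ (coloringSchedule f)) V pos A D).card : ℝ) := by
  classical
  have hclosed : ∀ v ∈ D, ∀ w ∈ A,
      gridCoord (pivotal α ε) (pos w) = gridCoord (pivotal α ε) (pos v) → w ∈ D := by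
    intro v hv w hw h
    by_contra hwD
    exact hwD (hsingle w hw hwD v (hDA hv) h.symm ▸ hv)
  have hsub : successful α ε hδ (dilution δ (coloringSchedule f)) V pos A D ⊆ D :=
    Finset.filter_subset _ _
  have hGP : ∀ P ⊆ A, ∀ b, Set.InjOn (fun v => gridCoord (pivotal α ε) (pos v)) P →
      (∀ v ∈ P, SameClass δ (gridCoord (pivotal α ε) (pos v)) b) →
      (∀ v ∈ P, gridCoord (pivotal α ε) (pos v) ≠ b) →
      ∑ v ∈ P, boxInterference (pivotal α ε) (gridCoord (pivotal α ε) (pos v)) b ≤ ε / 8 :=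
    fun P _ b hinj hclass hne => (sum_boxInterference_le hδ P
      ((Finset.card_le_univ P).trans_eq (Fintype.card_fin N)) _ b hinj hclass hne).trans hG
  have hfail := two_mul_card_le_of_interference (δ := δ) (c := pivotal α ε)
    (box := fun v => gridCoord (pivotal α ε) (pos v)) hk f hDA
    (F := D \ successful α ε hδ (dilution δ (coloringSchedule f)) V pos A D)
    Finset.sdiff_subset hsingle (card_not_isolated_sum_le hf hDA hA hclosed) hε hGP (by
      intro v hv s hviso
      obtain ⟨hvD, hvfail⟩ := Finset.mem_sdiff.mp hv
      by_contra! hint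
      obtain ⟨κ, hκ⟩ := exists_transmitters_eq hδ f (pivotal α ε) pos A v s
      refine hvfail (Finset.mem_filter.mpr ⟨hvD, κ, ?_⟩)
      rw [hκ]
      exact transmitsSuccessfully_of_isolated hα hε hδ5 hδγ hpos hAV (hDA hvD) (f s) hviso hint)
  have hsum := Finset.card_sdiff_add_card_eq_card hsub
  have : (D.card : ℝ) ≤
      2 * (successful α ε hδ (dilution δ (coloringSchedule f)) V pos A D).card := by
    exact_mod_cast (by omega : D.card ≤
      2 * (successful α ε hδ (dilution δ (coloringSchedule f)) V pos A D).card)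
  linarith

theorem isSINRSelector_coloringSchedule {N k Q δ Δ : ℕ} {α ε : ℝ} (hα : 2 ≤ α) (hε : 0 < ε)
    (hδ : 0 < δ) (hδ5 : 5 ≤ δ) (hδγ : 2 ≤ pivotal α ε * δ)
    (hG : 4 / (pivotal α ε ^ 2 * δ ^ 2) * (9 + 8 * Real.log N) ≤ ε / 8)
    (hk : 0 < k) {f : Fin k → Fin N → Fin Q}
    (hf : ∀ X : Finset (Fin N), X.card ≤ Δ →
      8 * ∑ s, (X.card - (X.image (f s)).card) ≤ k * X.card) :
    IsSINRSelector α ε hδ Δ (1 / 2) (dilution δ (coloringSchedule f)) := by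
  intro V pos hpos A hAV hA
  refine ⟨half_card_le_successful hα hε hδ hδ5 hδγ hG hk hf hpos hAV hA subset_rfl
    fun v hv hv' => absurd hv hv',
    half_card_le_successful hα hε hδ hδ5 hδγ hG hk hf hpos hAV hA (Finset.filter_subset _ _) ?_⟩
  intro v hv hvB w hw h
  by_contra hwv
  exact hvB (Finset.mem_filter.mpr ⟨hv, w, hw, hwv, h⟩)

/-! ### The choice of parameters -/

theorem exists_dilution_parameter {α ε : ℝ} (hε : 0 < ε) :
    ∃ M : ℝ, 0 < M ∧ ∀ N : ℕ, ∃ δ : ℕ, 5 ≤ δ ∧ 2 ≤ pivotal α ε * δ ∧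
      4 / (pivotal α ε ^ 2 * δ ^ 2) * (9 + 8 * Real.log N) ≤ ε / 8 ∧
      (2 ≤ N → (δ : ℝ) ^ 2 ≤ M * Real.log N) := by
  have hγ := pivotal_pos (α := α) hε
  set γ := pivotal α ε
  -- The summands secure, in order, the interference bound (`288 = 4 * 9 * 8`), `5 ≤ δ` and `2 ≤ γ *
  -- δ`.
  set K : ℝ := 288 / (γ ^ 2 * ε) + 25 + 4 / γ ^ 2 with hK
  have hK1 : 288 / (γ ^ 2 * ε) ≤ K := by
    have : 0 < 4 / γ ^ 2 := by positivity
    linarith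
  have hK2 : 25 ≤ K := by
    have : 0 < 4 / γ ^ 2 := by positivity
    have : 0 < 288 / (γ ^ 2 * ε) := by positivity
    linarith
  have hK3 : 4 / γ ^ 2 ≤ K := by
    have : 0 < 288 / (γ ^ 2 * ε) := by positivity
    linarith
  -- Rounding up at most doubles the root, and `1 ≤ 2 * log N` for `N ≥ 2`, so `δ ^ 2 ≤ 4 * K * (1 +
  -- log N) ≤ 12 * K * log N`.
  refine ⟨12 * K, by linarith, fun N => ⟨⌈Real.sqrt (K * (1 + Real.log N))⌉₊, ?_⟩⟩
  have hlog : 0 ≤ Real.log N := Real.log_natCast_nonneg N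
  set x := Real.sqrt (K * (1 + Real.log N))
  have hx2 : x ^ 2 = K * (1 + Real.log N) := Real.sq_sqrt (by nlinarith)
  have hx0 : 0 ≤ x := Real.sqrt_nonneg _
  have hx5 : 5 ≤ x := by nlinarith
  have hle : x ≤ (⌈x⌉₊ : ℝ) := Nat.le_ceil x
  have hlt : (⌈x⌉₊ : ℝ) < x + 1 := Nat.ceil_lt_add_one hx0
  set d : ℝ := (⌈x⌉₊ : ℝ) with hd
  refine ⟨?_, ?_, ?_, fun hN => ?_⟩
  · have : (5 : ℝ) ≤ d := hx5.trans hle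
    rw [hd] at this
    exact_mod_cast this
  · rw [div_le_iff₀ (by positivity)] at hK3
    have : 4 ≤ (γ * d) ^ 2 := by
      rw [mul_pow]
      have : K ≤ d ^ 2 := by nlinarith
      nlinarith [sq_nonneg γ]
    have h0 : 0 ≤ γ * d := by positivity
    nlinarith
  · rw [div_le_iff₀ (by positivity)] at hK1
    have h1 : K * (1 + Real.log N) ≤ d ^ 2 := by nlinarith
    have h2 : 0 < d := by linarith
    rw [div_mul_eq_mul_div, div_le_iff₀ (by positivity)]
    have h3 : 0 < γ ^ 2 * ε := by positivity
    have h4 : 288 * (1 + Real.log N) ≤ γ ^ 2 * ε * d ^ 2 := by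
      calc _ ≤ K * (γ ^ 2 * ε) * (1 + Real.log N) := by gcongr
        _ = γ ^ 2 * ε * (K * (1 + Real.log N)) := by ring
        _ ≤ _ := by gcongr
    nlinarith
  · have h1 : Real.log 2 ≤ Real.log N := by
      gcongr
      exact_mod_cast hN
    have h2 := Real.log_two_gt_d9
    have h3 : d ^ 2 ≤ 4 * x ^ 2 := by nlinarith
    rw [hx2] at h3
    nlinarith

theorem natLog_add_two_le {N : ℕ} (hN : 2 ≤ N) :
    ((Nat.log 2 N + 2 : ℕ) : ℝ) ≤ 6 * Real.log N := by
  have h2 := Real.log_two_gt_d9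
  have h1 : Real.log 2 ≤ Real.log N := by
    gcongr
    exact_mod_cast hN
  have h3 : (Nat.log 2 N : ℝ) * Real.log 2 ≤ Real.log N := by
    rw [← Real.log_pow]
    have : ((2 : ℝ) ^ Nat.log 2 N) ≤ N := by exact_mod_cast Nat.pow_log_le_self 2 (by omega)
    gcongr
  push_cast
  nlinarith [(Nat.cast_nonneg (Nat.log 2 N) : (0 : ℝ) ≤ _)]

theorem lemmal (α ε : ℝ) (hα : 2 ≤ α) (hε : 0 < ε) :
    ∃ C : ℝ, 0 < C ∧ ∀ N Δ : ℕ, Δ ≤ N →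
      ∃ (δ : ℕ) (hδ : 0 < δ) (T : ℕ) (S : Schedule N T) (S' : GeomSchedule N δ (T * δ ^ 2)),
        S' = dilution δ S ∧
        IsSINRSelector α ε hδ Δ (1 / 2) S' ∧
        (2 ≤ N →
          (δ : ℝ) ≤ C * Real.log N ∧
          (2 < α → ((T * δ ^ 2 : ℕ) : ℝ) ≤ C * Δ * Real.log N ^ 2) ∧
          (α = 2 → ((T * δ ^ 2 : ℕ) : ℝ) ≤ C * Δ * Real.log N ^ 3)) := by
  obtain ⟨M, hM, hpar⟩ := exists_dilution_parameter (α := α) hε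
  -- The factor 2 pays for the extra logarithm at `α = 2`, since `1 ≤ 2 * log N`.
  refine ⟨2 * (6 * 2 ^ 16 * M), by positivity, fun N Δ _ => ?_⟩
  obtain ⟨δ, hδ5, hδγ, hG, hδM⟩ := hpar N
  have hδ : 0 < δ := by omega
  set k := Nat.log 2 N + 2 with hk
  have hlen : 2 ≤ N → ((k * (2 ^ 16 * Δ) * δ ^ 2 : ℕ) : ℝ) ≤
      6 * 2 ^ 16 * M * Δ * Real.log N ^ 2 := by
    intro hN
    calc ((k * (2 ^ 16 * Δ) * δ ^ 2 : ℕ) : ℝ) = (k : ℝ) * (2 ^ 16 * Δ) * (δ : ℝ) ^ 2 := by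
          push_cast
          ring
      _ ≤ (6 * Real.log N) * (2 ^ 16 * Δ) * (M * Real.log N) := by
          have := natLog_add_two_le hN
          have := hδM hN
          have := Real.log_natCast_nonneg N
          gcongr
      _ = _ := by ring
  have hsel : ∃ S : Schedule N (k * (2 ^ 16 * Δ)),
      IsSINRSelector α ε hδ Δ (1 / 2) (dilution δ S) := by
    rcases Nat.eq_zero_or_pos Δ with rfl | hΔ
    -- With `Δ = 0` there are no colours to use, but `A` is empty.
    · refine ⟨fun _ _ => false, fun V pos _ A _ hA => ?_⟩
      have hA0 : A = ∅ := Finset.eq_empty_of_forall_notMem fun v hv => by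
        have h0 := Finset.card_eq_zero.mp
          (Nat.le_zero.mp (hA (gridCoord (pivotal α ε) (pos v))))
        exact Finset.filter_eq_empty_iff.mp h0 hv rfl
      subst hA0
      simp [sharing]
    · have hpow : 2 * Fintype.card (Fin N) ≤ 2 ^ k := by
        have := Nat.lt_pow_succ_log_self (b := 2) (by norm_num) N
        rw [Fintype.card_fin, hk, pow_succ]
        omega
      obtain ⟨f, hf⟩ := exists_colorings (V := Fin N) (β := Fin (2 ^ 16 * Δ)) (Δ := Δ)
        (by simp) (by simpa using hΔ) hpow
      exact ⟨coloringSchedule f,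
        isSINRSelector_coloringSchedule hα hε hδ hδ5 hδγ hG (by omega) hf⟩
  obtain ⟨S, hS⟩ := hsel
  refine ⟨δ, hδ, _, S, _, rfl, hS, fun hN => ?_⟩
  have hlog : 1 / 2 ≤ Real.log N := by
    have h1 : Real.log 2 ≤ Real.log N := by
      gcongr
      exact_mod_cast hN
    linarith [Real.log_two_gt_d9]
  have hX : 0 ≤ 6 * 2 ^ 16 * M * Δ * Real.log N ^ 2 := by positivity
  refine ⟨?_, fun _ => (hlen hN).trans (by nlinarith), fun _ => (hlen hN).trans ?_⟩
  · have h1 : (1 : ℝ) ≤ δ := by exact_mod_cast hδ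
    have h2 := hδM hN
    have h3 : 0 ≤ M * Real.log N := by positivity
    nlinarith
  · calc _ ≤ 6 * 2 ^ 16 * M * Δ * Real.log N ^ 2 * (2 * Real.log N) :=
          le_mul_of_one_le_right hX (by linarith)
      _ = _ := by ring
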